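/- Work with CNF formulas. A literal is a variable $v$ or its negation $\neg v$; a clause is a finite set of literals containing no complementary pair; a formula is a finite set of clauses, and its size $|\varphi|$ is its number of clauses. Two clauses $C,D$ are resolvable if there is exactly one literal $l$ with $l\in C$ and $\neg l\in D$; their resolvent is then $(C\cup D)\setminus\{l,\neg l\}$. Write $\varphi\vdash_1 C$ if $C$ can be obtained from clauses of $\varphi$ by a (possibly empty) series of resolution steps, each of which has at least one unit (one-literal) clause among its two premises (unit propagation). A formula $\varphi(x_1,\dots,x_n,y_1,\dots,y_\ell)$ with $n\ge 1$ input variables $x_i$ and $\ell\ge 0$ auxiliary variables $y_j$ is a *P-encoding* if (i) $\varphi\wedge x_i$ is satisfiable for every $i$, and (ii) $\varphi\wedge x_i\vdash_1\neg x_j$ for all $i\ne j$. Let $P(n)$ be the minimum size of a P-encoding with $n$ input variables (and any number $\ell$ of auxiliary variables). **Theorem.** Let $n\ge 3$. 1. If $n\le 8$, then $P(n)=3n-6$. 2. If $n\ge 9$, then $P(n)\ge 2n+\sqrt{n}-2$. -/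

import Mathlib

namespace PEnc

/-- A literal over a set `V` of variables: `(v, true)` is the positive literal `v`,
`(v, false)` is the negative literal `¬ v`. -/
abbrev Lit (V : Type) : Type := V × Bool

/-- The positive literal on the variable `v`. -/
def pos {V : Type} (v : V) : Lit V := (v, true)

/-- The negative literal on the variable `v`. -/
def neg {V : Type} (v : V) : Lit V := (v, false)

/-- The complementary literal. -/
def Lit.compl {V : Type} (l : Lit V) : Lit V := (l.1, !l.2)

/-- A set of literals, read as their disjunction. -/
abbrev LitSet (V : Type) : Type := Finset (Lit V)

/-- A clause is a set of literals without a complementary pair (the empty clause is allowed). -/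
def IsClause {V : Type} (C : LitSet V) : Prop := ∀ l ∈ C, l.compl ∉ C

/-- A CNF formula over the variables `V`: a finite set of clauses. -/
structure Formula (V : Type) where
  clauses : Finset (LitSet V)
  isClause : ∀ C ∈ clauses, IsClause C

/-- The size of a formula is the number of its clauses. -/
def Formula.size {V : Type} (φ : Formula V) : ℕ := φ.clauses.card

/-- The assignment `α` satisfies the clause `C`. -/
def SatisfiesClause {V : Type} (α : V → Bool) (C : LitSet V) : Prop := ∃ l ∈ C, α l.1 = l.2

/-- A formula is satisfiable if some assignment satisfies all its clauses. -/
def Formula.Satisfiable {V : Type} (φ : Formula V) : Prop :=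
  ∃ α : V → Bool, ∀ C ∈ φ.clauses, SatisfiesClause α C

theorem isClause_singleton {V : Type} (l : Lit V) : IsClause ({l} : LitSet V) := by
  rintro m hm h
  rw [Finset.mem_singleton] at hm h
  subst hm
  have := congrArg Prod.snd h
  simp [Lit.compl] at this

/-- The formula `φ ∧ l`, that is, `φ` with the unit clause `{l}` added. -/
def Formula.andLit {V : Type} [DecidableEq V] (φ : Formula V) (l : Lit V) : Formula V where
  clauses := insert {l} φ.clauses
  isClause := by
    intro C hC
    rcases Finset.mem_insert.1 hC with rfl | hC
    · exact isClause_singleton l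
    · exact φ.isClause C hC

/-- `C` and `D` are resolvable, and `l` is the unique literal with `l ∈ C` and `¬ l ∈ D`. -/
def ResolvableOn {V : Type} (C D : LitSet V) (l : Lit V) : Prop :=
  (l ∈ C ∧ l.compl ∈ D) ∧ ∀ m : Lit V, m ∈ C → m.compl ∈ D → m = l

/-- The resolvent of `C` and `D` on the literal `l`. -/
def resolvent {V : Type} [DecidableEq V] (C D : LitSet V) (l : Lit V) : LitSet V :=
  (C ∪ D) \ {l, l.compl}

/-- `φ.UnitDerives C` means `φ ⊢₁ C`: the clause `C` can be obtained from clauses of `φ`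
by a series of resolution steps, each of which has a unit clause among its two premises. -/
inductive Formula.UnitDerives {V : Type} [DecidableEq V] (φ : Formula V) : LitSet V → Prop
  | of_mem (C : LitSet V) (hC : C ∈ φ.clauses) : Formula.UnitDerives φ C
  | resolve (C D : LitSet V) (l : Lit V)
      (hC : Formula.UnitDerives φ C) (hD : Formula.UnitDerives φ D)
      (hunit : C.card = 1 ∨ D.card = 1) (hres : ResolvableOn C D l) :
      Formula.UnitDerives φ (resolvent C D l)

/-- The variables of a formula `φ(x, y)` with `n` input variables `x₁, …, xₙ` and
`ℓ` auxiliary variables `y₁, …, y_ℓ`. -/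
abbrev Vars (n ℓ : ℕ) : Type := Fin n ⊕ Fin ℓ

/-- The `i`-th input variable. -/
def input {n : ℕ} (ℓ : ℕ) (i : Fin n) : Vars n ℓ := Sum.inl i

/-- `φ(x, y)` is a P-encoding: `φ ∧ xᵢ` is satisfiable for every `i`, and
`φ ∧ xᵢ ⊢₁ ¬ xⱼ` for all `i ≠ j`. -/
structure IsPEncoding {n ℓ : ℕ} (φ : Formula (Vars n ℓ)) : Prop where
  satisfiable : ∀ i : Fin n, (φ.andLit (pos (input ℓ i))).Satisfiable
  derives : ∀ i j : Fin n, i ≠ j →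
    (φ.andLit (pos (input ℓ i))).UnitDerives {neg (input ℓ j)}

/-- The set of sizes of P-encodings with `n` input variables
(and any finite number of auxiliary variables). -/
def pEncSizes (n : ℕ) : Set ℕ :=
  {s | ∃ (ℓ : ℕ) (φ : Formula (Vars n ℓ)), IsPEncoding φ ∧ φ.size = s}

/-- `P(n)`: the minimum size of a P-encoding with `n` input variables
(an honest minimum, see `pEncSize_isLeast`). -/
noncomputable def pEncSize (n : ℕ) : ℕ := sInf (pEncSizes n)

/-- The formula of all clauses `¬ xᵢ ∨ ¬ xⱼ` with `i ≠ j`, without auxiliary variables. -/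
def pairwise (n : ℕ) : Formula (Vars n 0) where
  clauses := (Finset.univ.filter fun p : Fin n × Fin n => p.1 ≠ p.2).image
    fun p => {neg (input 0 p.1), neg (input 0 p.2)}
  isClause := by
    intro C hC l hl h
    obtain ⟨p, -, rfl⟩ := Finset.mem_image.1 hC
    have key : ∀ m ∈ ({neg (input 0 p.1), neg (input 0 p.2)} : LitSet (Vars n 0)),
        m.2 = false := by
      intro m hm
      rcases Finset.mem_insert.1 hm with rfl | hm
      · rfl
      · rw [Finset.mem_singleton.1 hm]; rfl
    have h1 := key _ hl
    have h2 := key _ h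
    simp [Lit.compl, h1] at h2

theorem pairwise_isPEncoding (n : ℕ) : IsPEncoding (pairwise n) where
  satisfiable := by
    intro i
    refine ⟨fun v => decide (v = input 0 i), ?_⟩
    intro C hC
    rcases Finset.mem_insert.1 hC with rfl | hC
    · exact ⟨_, Finset.mem_singleton_self _, by simp [pos]⟩
    · obtain ⟨p, hp, rfl⟩ := Finset.mem_image.1 hC
      have hne : p.1 ≠ p.2 := (Finset.mem_filter.1 hp).2
      by_cases h : p.1 = i
      · refine ⟨neg (input 0 p.2), by simp, ?_⟩
        have : p.2 ≠ i := fun h' => hne (h.trans h'.symm)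
        simpa [neg, input] using this
      · refine ⟨neg (input 0 p.1), by simp, ?_⟩
        simpa [neg, input] using h
  derives := by
    intro i j hij
    have h := Formula.UnitDerives.resolve (φ := (pairwise n).andLit (pos (input 0 i)))
      {pos (input 0 i)} {neg (input 0 i), neg (input 0 j)} (pos (input 0 i))
      (.of_mem _ (Finset.mem_insert_self _ _))
      (.of_mem _ (Finset.mem_insert_of_mem (Finset.mem_image.2
        ⟨(i, j), by simpa using hij, rfl⟩)))
      (Or.inl (Finset.card_singleton _))
      ⟨⟨by simp, by simp [pos, neg, Lit.compl]⟩, fun m hm _ => Finset.mem_singleton.1 hm⟩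
    have hji : j ≠ i := hij.symm
    have e : resolvent {pos (input 0 i)} {neg (input 0 i), neg (input 0 j)} (pos (input 0 i))
        = ({neg (input 0 j)} : LitSet (Vars n 0)) := by
      ext ⟨v, b⟩
      simp only [resolvent, pos, neg, input, Lit.compl, Finset.mem_sdiff, Finset.mem_union,
        Finset.mem_insert, Finset.mem_singleton, Prod.mk.injEq]
      constructor
      · rintro ⟨h1, h2⟩
        simp at h2
        grind
      · rintro ⟨rfl, rfl⟩
        simp [hji]
    rwa [e] at h

theorem pEncSize_isLeast (n : ℕ) : IsLeast (pEncSizes n) (pEncSize n) :=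
  ⟨Nat.sInf_mem ⟨_, 0, pairwise n, pairwise_isPEncoding n, rfl⟩, fun _ h => Nat.sInf_le h⟩

end PEnc

namespace PEnc

/-! ### Unit propagation as closure on literals -/

section Propagation

variable {V : Type} [DecidableEq V]

/-! Inputs are generalised to a set `X` of literals, so that an input may be replaced by an
arbitrary literal. For the lower bound, a clause containing `¬u` with `u` an input can be cut down
to a binary clause `{¬u, b}`; and if `¬u` lies in only one clause `{¬u, d}`, then `u` and `d` are
interchangeable and that clause can be saved. So every `¬u` may be assumed to lie in at least two
clauses.

If some `¬u` lies in three clauses, or two negated inputs share a clause, one input can be removed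
together with three clauses, and induction applies (`Reduced.regular_or`). Otherwise there are
exactly `2n + r` clauses, where `r` counts those without negated inputs, and every input `w` implies
exactly two neighbours `a`, `b`, one of which is refuted by each other input.

A fixed input `u` propagates at most `r + 2` non-input literals, since each needs its own clause,
and at most `max 2 (r + 1)` inputs share a neighbour. Hence `n ≤ max 2 (r + 1) * (r + 2) + 1`
(`Regular.card_inputs_le`), which bounds `r` from below.

The upper bound `3n - 6` starts from the three pairwise clauses at `n = 3` and splits one input into
two at a cost of three clauses (`IsPEncoding.exists_succ`). -/

@[simp] theorem Lit.compl_compl {V : Type} (l : Lit V) : l.compl.compl = l := by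
  simp [Lit.compl]

theorem Lit.compl_injective {V : Type} : Function.Injective (Lit.compl (V := V)) :=
  Function.LeftInverse.injective Lit.compl_compl

@[simp] theorem Lit.compl_inj {V : Type} {l m : Lit V} : l.compl = m.compl ↔ l = m :=
  Lit.compl_injective.eq_iff

theorem Lit.compl_eq_iff {V : Type} {l m : Lit V} : l.compl = m ↔ l = m.compl := by
  rw [← Lit.compl_inj, Lit.compl_compl]

theorem Lit.compl_ne {V : Type} (l : Lit V) : l.compl ≠ l := by
  intro h
  have := congrArg Prod.snd h
  simp [Lit.compl] at this

/-- The assignment `α` makes the literal `l` true. -/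
def Holds {V : Type} (α : V → Bool) (l : Lit V) : Prop := α l.1 = l.2

theorem holds_compl {V : Type} {α : V → Bool} {l : Lit V} : Holds α l.compl ↔ ¬ Holds α l := by
  unfold Holds Lit.compl
  cases α l.1 <;> cases l.2 <;> simp

/-- The assignment `α` satisfies all the clauses in `F`. -/
def Models {V : Type} (α : V → Bool) (F : Finset (LitSet V)) : Prop :=
  ∀ C ∈ F, ∃ l ∈ C, Holds α l

/-- `UP F u l`: unit propagation in `F`, started with the literal `u`, produces the literal `l`. -/
inductive UP {V : Type} (F : Finset (LitSet V)) (u : Lit V) : Lit V → Prop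
  | start : UP F u u
  | step (C : LitSet V) (l : Lit V) (hC : C ∈ F) (hl : l ∈ C)
      (h : ∀ m ∈ C, m ≠ l → UP F u m.compl) : UP F u l

theorem UP.holds {V : Type} {F : Finset (LitSet V)} {u l : Lit V} {α : V → Bool}
    (h : UP F u l) (hF : Models α F) (hu : Holds α u) : Holds α l := by
  induction h with
  | start => exact hu
  | step C l hC hl _ ih =>
    obtain ⟨m, hm, hαm⟩ := hF C hC
    by_cases hml : m = l
    · exact hml ▸ hαm
    · exact absurd hαm (holds_compl.1 (ih m hm hml))

/-- The invariant of unit resolution: each step only strips from an original clause literals whose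
complements have been propagated. -/
theorem UnitDerives.exists_superset {φ : Formula V} {u : Lit V} {D : LitSet V}
    (h : (φ.andLit u).UnitDerives D) :
    ∃ C ∈ (φ.andLit u).clauses, D ⊆ C ∧ ∀ m ∈ C, m ∉ D → UP φ.clauses u m.compl := by
  have unit : ∀ (l : Lit V) (D : LitSet V), l ∈ D → D.card = 1 →
      (∃ C ∈ (φ.andLit u).clauses, D ⊆ C ∧ ∀ m ∈ C, m ∉ D → UP φ.clauses u m.compl) →
      D = {l} ∧ UP φ.clauses u l := by
    rintro l D hl hD ⟨C, hC, hDC, h⟩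
    obtain ⟨l', rfl⟩ := Finset.card_eq_one.1 hD
    obtain rfl := Finset.mem_singleton.1 hl
    refine ⟨rfl, ?_⟩
    rcases Finset.mem_insert.1 hC with rfl | hC
    · obtain rfl := Finset.mem_singleton.1 (hDC hl)
      exact .start
    · exact .step C l hC (hDC hl) fun m hm hml => h m hm (by simpa using hml)
  have main : ∀ (l : Lit V) (D : LitSet V), UP φ.clauses u l →
      (∃ C ∈ (φ.andLit u).clauses, D ⊆ C ∧ ∀ m ∈ C, m ∉ D → UP φ.clauses u m.compl) →
      l.compl ∈ D → ∃ C ∈ (φ.andLit u).clauses, ({l} ∪ D) \ {l, l.compl} ⊆ C ∧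
        ∀ m ∈ C, m ∉ ({l} ∪ D) \ {l, l.compl} → UP φ.clauses u m.compl := by
    rintro l D hl ⟨C, hC, hDC, h⟩ hlD
    refine ⟨C, hC, fun m hm => hDC ?_, fun m hm hmD => ?_⟩
    · simp only [Finset.mem_sdiff, Finset.mem_union, Finset.mem_insert, Finset.mem_singleton] at hm
      tauto
    · by_cases hmD' : m ∈ D
      · have hne : m ≠ l := by
          rintro rfl
          exact (φ.andLit u).isClause C hC m hm (hDC hlD)
        have : m = l.compl := by
          simp only [Finset.mem_sdiff, Finset.mem_union, Finset.mem_insert,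
            Finset.mem_singleton] at hmD
          tauto
        rw [this, Lit.compl_compl]
        exact hl
      · exact h m hm hmD'
  induction h with
  | of_mem C hC => exact ⟨C, hC, subset_rfl, fun m hm hm' => absurd hm hm'⟩
  | resolve C D l _ _ hunit hres ihC ihD =>
    obtain ⟨⟨hlC, hlD⟩, -⟩ := hres
    rcases hunit with h1 | h1
    · obtain ⟨rfl, hl⟩ := unit l C hlC h1 ihC
      exact main l D hl ihD hlD
    · obtain ⟨rfl, hl⟩ := unit l.compl D hlD h1 ihD
      have := main l.compl C hl ihC (by simpa using hlC)
      rwa [Lit.compl_compl, Finset.union_comm, Finset.pair_comm] at this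

theorem unitDerives_singleton_iff {φ : Formula V} {u l : Lit V} :
    (φ.andLit u).UnitDerives {l} ↔ UP φ.clauses u l := by
  constructor
  · intro h
    obtain ⟨C, hC, hlC, h⟩ := UnitDerives.exists_superset h
    rw [Finset.singleton_subset_iff] at hlC
    rcases Finset.mem_insert.1 hC with rfl | hC
    · obtain rfl := Finset.mem_singleton.1 hlC
      exact .start
    · exact .step C l hC hlC fun m hm hml => h m hm (by simpa using hml)
  · intro h
    induction h with
    | start => exact .of_mem _ (Finset.mem_insert_self _ _)
    | step C l hC hl _ ih =>
      -- The falsified literals of `C` are resolved away one at a time.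
      have key : ∀ S : Finset (Lit V), S ⊆ C → l ∉ S → (φ.andLit u).UnitDerives (C \ S) := by
        intro S
        induction S using Finset.induction_on with
        | empty =>
          intro _ _
          rw [Finset.sdiff_empty]
          exact .of_mem _ (Finset.mem_insert_of_mem hC)
        | insert m S hmS ihS =>
          intro hS hlS
          have hm : m ∈ C := hS (Finset.mem_insert_self _ _)
          have hml : m ≠ l := fun h => hlS (h ▸ Finset.mem_insert_self _ _)
          have hmC : m.compl ∉ C := φ.isClause C hC m hm
          have hD := ihS (fun x hx => hS (Finset.mem_insert_of_mem hx))
            (fun h => hlS (Finset.mem_insert_of_mem h))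
          have := Formula.UnitDerives.resolve {m.compl} (C \ S) m.compl (ih m hm hml) hD
            (Or.inl (Finset.card_singleton _))
            ⟨⟨by simp, by simp [hm, hmS]⟩, fun m' hm' _ => Finset.mem_singleton.1 hm'⟩
          convert this using 1
          ext x
          simp only [resolvent, Lit.compl_compl, Finset.mem_sdiff, Finset.mem_insert,
            Finset.mem_union, Finset.mem_singleton]
          constructor
          · rintro ⟨h1, h2⟩
            push Not at h2
            exact ⟨Or.inr ⟨h1, h2.2⟩, fun h => h.elim (fun h => hmC (h ▸ h1)) h2.1⟩
          · tauto
      have := key (C.erase l) (Finset.erase_subset _ _) (by simp)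
      rwa [show C \ C.erase l = {l} by ext x; simp; grind] at this

/-- The formula `F` over `V` behaves as a P-encoding with the literals in `X` as its inputs. -/
structure Encodes {V : Type} (F : Finset (LitSet V)) (X : Finset (Lit V)) : Prop where
  sat : ∀ u ∈ X, ∃ α, Models α F ∧ Holds α u
  prop : ∀ u ∈ X, ∀ v ∈ X, u ≠ v → UP F u v.compl

theorem Encodes.consistent {V : Type} {F : Finset (LitSet V)} {X : Finset (Lit V)} {u l : Lit V}
    (h : Encodes F X) (hu : u ∈ X) (hl : UP F u l) : ¬ UP F u l.compl := by
  obtain ⟨α, hα, hαu⟩ := h.sat u hu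
  exact fun hl' => holds_compl.1 (hl'.holds hα hαu) (hl.holds hα hαu)

end Propagation

/-! ### Transformations that do not increase the number of clauses -/

section Transformations

variable {V : Type} [DecidableEq V] {F : Finset (LitSet V)} {X : Finset (Lit V)} {u v d : Lit V}

/-- Dropping the tautological clauses keeps an encoding. -/
theorem Encodes.exists_isClause (h : Encodes F X) :
    ∃ G ⊆ F, Encodes G X ∧ ∀ C ∈ G, IsClause C := by
  classical
  refine ⟨F.filter IsClause, Finset.filter_subset _ _, ⟨fun u hu => ?_, fun u hu v hv huv => ?_⟩,
    fun C hC => (Finset.mem_filter.1 hC).2⟩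
  · obtain ⟨α, hα, hαu⟩ := h.sat u hu
    exact ⟨α, fun C hC => hα C (Finset.mem_filter.1 hC).1, hαu⟩
  · have main : ∀ l, UP F u l → UP (F.filter IsClause) u l := by
      intro l hl
      induction hl with
      | start => exact .start
      | step C l hC hl hUP ih =>
        by_cases hcl : IsClause C
        · exact .step C l (Finset.mem_filter.2 ⟨hC, hcl⟩) hl ih
        -- A step through a clause containing `m` and `¬m` either concludes what was already a
        -- premise or needs both literals propagated.
        · unfold IsClause at hcl
          push Not at hcl
          obtain ⟨m, hm, hm'⟩ := hcl
          by_cases hml : m = l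
          · subst hml
            simpa using ih _ hm' m.compl_ne
          · by_cases hml' : m.compl = l
            · subst hml'
              exact ih _ hm hml
            · exact absurd (hUP _ hm' hml') (h.consistent hu (hUP _ hm hml))
    exact main _ (h.prop u hu v hv huv)

/-- Every clause containing a negated input can be shortened to a binary one. -/
theorem Encodes.exists_binary (h : Encodes F X) (hF : ∀ C ∈ F, IsClause C) :
    ∃ G : Finset (LitSet V), G.card ≤ F.card ∧ Encodes G X ∧ (∀ C ∈ G, IsClause C) ∧
      ∀ C ∈ G, ∀ u ∈ X, u.compl ∈ C → ∃ b, C = {u.compl, b} := by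
  classical
  choose! α hα hαu using h.sat
  -- The literal `b` to keep is one that a fixed model of `F ∧ u` satisfies; in the models for the
  -- other inputs `¬u` itself is true.
  have hg : ∀ C ∈ F, ∃ D : LitSet V, (D = C ∧ ∀ u ∈ X, u.compl ∉ C) ∨
      ∃ u ∈ X, ∃ b ∈ C, u.compl ∈ C ∧ D = {u.compl, b} ∧ Holds (α u) b := by
    intro C hC
    by_cases hex : ∃ u ∈ X, u.compl ∈ C
    · obtain ⟨u, hu, huC⟩ := hex
      obtain ⟨b, hb, hαb⟩ := hα u hu C hC
      exact ⟨_, Or.inr ⟨u, hu, b, hb, huC, rfl, hαb⟩⟩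
    · push Not at hex
      exact ⟨C, Or.inl ⟨rfl, hex⟩⟩
  choose! g hg using hg
  refine ⟨F.image g, Finset.card_image_le, ⟨fun v hv => ⟨α v, ?_, hαu v hv⟩, ?_⟩, ?_, ?_⟩
  · intro D hD
    obtain ⟨C, hC, rfl⟩ := Finset.mem_image.1 hD
    rcases hg C hC with ⟨h1, -⟩ | ⟨u, hu, b, hb, huC, h1, hαb⟩
    · rw [h1]
      exact hα v hv C hC
    · rw [h1]
      by_cases huv : v = u
      · exact ⟨b, by simp, huv ▸ hαb⟩
      · exact ⟨u.compl, by simp, (h.prop v hv u hu huv).holds (hα v hv) (hαu v hv)⟩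
  · intro v hv w hw hvw
    have main : ∀ l, UP F v l → UP (F.image g) v l := by
      intro l hl
      induction hl with
      | start => exact .start
      | step C l hC hl hUP ih =>
        have hgC := Finset.mem_image_of_mem g hC
        rcases hg C hC with ⟨h1, -⟩ | ⟨u, hu, b, hb, huC, h1, hαb⟩
        · rw [h1] at hgC
          exact .step C l hgC hl ih
        · rw [h1] at hgC
          -- Propagation from `u` can only conclude `b`, since a premise `¬b` would be false in the
          -- model chosen for `u`. Propagation from another input can only conclude `¬u`, since it
          -- never yields `u`.
          by_cases huv : v = u
          · subst huv
            by_cases hlb : b = l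
            · subst hlb
              refine .step _ b hgC (by simp) fun m hm hmb => ?_
              have : m = v.compl := by simpa [hmb] using hm
              rw [this, Lit.compl_compl]
              exact .start
            · exact absurd hαb (holds_compl.1 ((hUP b hb hlb).holds (hα v hv) (hαu v hv)))
          · by_cases hlu : u.compl = l
            · subst hlu
              refine .step _ _ hgC (by simp) fun m hm hmb => ?_
              have : m = b := by simpa [hmb] using hm
              rw [this] at hmb ⊢
              exact ih b hb hmb
            · exact absurd (hUP _ huC hlu) (h.consistent hv (h.prop v hv u hu huv))
    exact main _ (h.prop v hv w hw hvw)
  · intro D hD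
    obtain ⟨C, hC, rfl⟩ := Finset.mem_image.1 hD
    have hsub : g C ⊆ C := by
      rcases hg C hC with ⟨h1, -⟩ | ⟨u, hu, b, hb, huC, h1, hαb⟩
      · rw [h1]
      · rw [h1]
        intro x hx
        rcases Finset.mem_insert.1 hx with rfl | hx
        · exact huC
        · exact Finset.mem_singleton.1 hx ▸ hb
    exact fun l hl hl' => hF C hC l (hsub hl) (hsub hl')
  · intro D hD w hw hwD
    obtain ⟨C, hC, rfl⟩ := Finset.mem_image.1 hD
    rcases hg C hC with ⟨h1, h2⟩ | ⟨u, hu, b, hb, huC, h1, hαb⟩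
    · rw [h1] at hwD
      exact absurd hwD (h2 w hw)
    · rw [h1] at hwD ⊢
      rcases Finset.mem_insert.1 hwD with hwu | hwb
      · exact ⟨b, by rw [hwu]⟩
      · rw [← Finset.mem_singleton.1 hwb]
        exact ⟨u.compl, Finset.pair_comm _ _⟩

/-- The clause set obtained by setting the literal `v` to false. -/
def restrict (F : Finset (LitSet V)) (v : Lit V) : Finset (LitSet V) :=
  (F.filter fun C => v.compl ∉ C).image fun C => C.erase v

/-- Every other input propagates `¬v`, so it never uses a clause containing `¬v` to derive anything
except `¬v`, and the literal `v` is false in its models. -/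
theorem Encodes.restrict (h : Encodes F X) (hv : v ∈ X) : Encodes (restrict F v) (X.erase v) := by
  refine ⟨fun u hu' => ?_, fun u hu w hw huw => ?_⟩
  · obtain ⟨huv, hu⟩ := Finset.mem_erase.1 hu'
    obtain ⟨α, hα, hαu⟩ := h.sat u hu
    refine ⟨α, fun D hD => ?_, hαu⟩
    obtain ⟨C, hC, rfl⟩ := Finset.mem_image.1 hD
    obtain ⟨l, hl, hαl⟩ := hα C (Finset.mem_filter.1 hC).1
    refine ⟨l, Finset.mem_erase.2 ⟨?_, hl⟩, hαl⟩
    rintro rfl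
    exact holds_compl.1 ((h.prop u hu l hv huv).holds hα hαu) hαl
  · obtain ⟨huv, hu⟩ := Finset.mem_erase.1 hu
    obtain ⟨hwv, hw⟩ := Finset.mem_erase.1 hw
    have hv' := h.consistent hu (h.prop u hu v hv huv)
    rw [Lit.compl_compl] at hv'
    have main : ∀ l, UP F u l → l ≠ v.compl → UP (PEnc.restrict F v) u l := by
      intro l hl
      induction hl with
      | start => exact fun _ => .start
      | step C l hC hl hUP ih =>
        intro hlv
        have hvC : v.compl ∉ C := fun hvC => hv' (by simpa using hUP _ hvC hlv.symm)
        refine .step (C.erase v) l (Finset.mem_image_of_mem _ (Finset.mem_filter.2 ⟨hC, hvC⟩))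
          (Finset.mem_erase.2 ⟨?_, hl⟩) fun m hm hml => ?_
        · rintro rfl
          exact hv' (.step C l hC hl hUP)
        · obtain ⟨hmv, hm⟩ := Finset.mem_erase.1 hm
          exact ih m hm hml (by simpa using hmv)
    exact main _ (h.prop u hu w hw huw) (by simpa using hwv)

theorem card_restrict_add_le (F : Finset (LitSet V)) (v : Lit V) :
    (restrict F v).card + (F.filter fun C => v.compl ∈ C).card ≤ F.card := by
  have h1 : (restrict F v).card ≤ (F.filter fun C => v.compl ∉ C).card := Finset.card_image_le
  have h2 := Finset.card_filter_add_card_filter_not (s := F) (fun C => v.compl ∈ C)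
  omega

/-- The literal substitution that replaces `u` by `d`. -/
def substLit (u d l : Lit V) : Lit V := if l = u then d else if l = u.compl then d.compl else l

theorem substLit_compl (u d l : Lit V) : substLit u d l.compl = (substLit u d l).compl := by
  have hu := u.compl_ne
  unfold substLit
  by_cases h1 : l = u
  · subst h1
    simp [hu]
  · by_cases h2 : l = u.compl
    · subst h2
      simp [hu]
    · have h3 : l.compl ≠ u := by rwa [Ne, Lit.compl_eq_iff]
      simp [h1, h2, h3]

theorem holds_substLit {α : V → Bool} (h : Holds α u ↔ Holds α d) (l : Lit V) :
    Holds α (substLit u d l) ↔ Holds α l := by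
  unfold substLit
  split_ifs with h1 h2
  · rw [h1, h]
  · rw [h2, holds_compl, holds_compl, h]
  · rfl

/-- A third input would propagate both `¬u` and `u`. -/
theorem Encodes.compl_notMem {V : Type} {F : Finset (LitSet V)} {X : Finset (Lit V)} {u : Lit V}
    (h : Encodes F X) (hX : 3 ≤ X.card) (hu : u ∈ X) : u.compl ∉ X := by
  classical
  intro hu'
  obtain ⟨w, hw, hwu⟩ : ∃ w ∈ X, w ∉ ({u, u.compl} : Finset (Lit V)) :=
    Finset.exists_mem_notMem_of_card_lt_card (Finset.card_le_two.trans_lt hX)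
  simp only [Finset.mem_insert, Finset.mem_singleton, not_or] at hwu
  exact h.consistent hw (h.prop w hw u hu hwu.1) (h.prop w hw _ hu' hwu.2)

/-- If `{¬ u, d}` is the only clause containing `¬ u`, then `u` can be replaced by `d`. -/
theorem Encodes.exists_card_lt (h : Encodes F X) (hX : 3 ≤ X.card) (hu : u ∈ X) (hdu : d ≠ u)
    (hd : ∀ C ∈ F, u.compl ∈ C → C = {u.compl, d}) :
    ∃ (G : Finset (LitSet V)) (Y : Finset (Lit V)),
      Encodes G Y ∧ Y.card = X.card ∧ G.card < F.card := by
  -- Another input reaches `¬u` only through the clause `{¬u, d}`, hence after `¬d`.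
  have hstep : ∀ w ∈ X, w ≠ u → {u.compl, d} ∈ F ∧ (d ≠ u.compl → UP F w d.compl) := by
    intro w hw hwu
    have hprop := h.prop w hw u hu hwu
    generalize hc : u.compl = c at hprop
    cases hprop with
    | start => exact absurd hw (hc ▸ h.compl_notMem hX hu)
    | step C l hC hl hUP =>
      subst hc
      have := hd C hC hl
      subst this
      exact ⟨hC, fun hd' => hUP d (by simp) hd'⟩
  obtain ⟨w₀, hw₀, hw₀u⟩ := Finset.exists_mem_ne (by omega : 1 < X.card) u
  have hCF := (hstep w₀ hw₀ hw₀u).1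
  have hdu' : d ≠ u.compl := by
    rintro rfl
    obtain ⟨α, hα, hαu⟩ := h.sat u hu
    obtain ⟨l, hl, hαl⟩ := hα _ hCF
    have : l = u.compl := by simpa using hl
    exact holds_compl.1 (this ▸ hαl) hαu
  have hσd : substLit u d d = d := by simp [substLit, hdu, hdu']
  have hσu : substLit u d u = d := by simp [substLit]
  have hUd : UP F u d := by
    refine .step _ d hCF (by simp) fun m hm hmd => ?_
    have : m = u.compl := by simpa [hmd] using hm
    rw [this, Lit.compl_compl]
    exact .start
  have hiff : ∀ w ∈ X, ∀ α, Models α F → Holds α w → (Holds α u ↔ Holds α d) := by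
    intro w hw α hα hαw
    by_cases hwu : w = u
    · subst hwu
      exact iff_of_true hαw (hUd.holds hα hαw)
    · exact iff_of_false (holds_compl.1 ((h.prop w hw u hu hwu).holds hα hαw))
        (holds_compl.1 (((hstep w hw hwu).2 hdu').holds hα hαw))
  refine ⟨(F.erase {u.compl, d}).image fun C => C.image (substLit u d), X.image (substLit u d),
    ⟨fun y hy => ?_, fun y hy z hz hyz => ?_⟩, Finset.card_image_of_injOn fun w hw z hz hwz => ?_,
    Finset.card_image_le.trans_lt (Finset.card_erase_lt_of_mem hCF)⟩
  · obtain ⟨w, hw, rfl⟩ := Finset.mem_image.1 hy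
    obtain ⟨α, hα, hαw⟩ := h.sat w hw
    have hi := hiff w hw α hα hαw
    refine ⟨α, fun D hD => ?_, (holds_substLit hi w).2 hαw⟩
    obtain ⟨C, hC, rfl⟩ := Finset.mem_image.1 hD
    obtain ⟨l, hl, hαl⟩ := hα C (Finset.mem_of_mem_erase hC)
    exact ⟨_, Finset.mem_image_of_mem _ hl, (holds_substLit hi l).2 hαl⟩
  · obtain ⟨w, hw, rfl⟩ := Finset.mem_image.1 hy
    obtain ⟨v, hv, rfl⟩ := Finset.mem_image.1 hz
    have hwv : w ≠ v := fun h => hyz (by rw [h])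
    rw [← substLit_compl]
    have hprop := h.prop w hw v hv hwv
    generalize v.compl = l at hprop
    induction hprop with
    | start => exact .start
    | step C l hC hl hUP ih =>
      -- A step through the deleted clause becomes void: after the substitution its conclusion
      -- equals its premise.
      by_cases hC0 : C = {u.compl, d}
      · subst hC0
        by_cases hld : l = d
        · subst hld
          have := ih u.compl (by simp) hdu'.symm
          rw [Lit.compl_compl, hσu] at this
          rwa [hσd]
        · have hlu : l = u.compl := by simpa [hld] using hl
          subst hlu
          have := ih d (by simp) hdu'
          rw [substLit_compl, hσd] at this
          rwa [substLit_compl, hσu]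
      · refine .step _ _ (Finset.mem_image_of_mem _ (Finset.mem_erase.2 ⟨hC0, hC⟩))
          (Finset.mem_image_of_mem _ hl) fun m hm hml => ?_
        obtain ⟨m, hm', rfl⟩ := Finset.mem_image.1 hm
        rw [← substLit_compl]
        exact ih m hm' fun h => hml (by rw [h])
  · by_contra hne
    obtain ⟨α, hα, hαw⟩ := h.sat w hw
    have hi := hiff w hw α hα hαw
    have hz' : Holds α (substLit u d z) := hwz ▸ (holds_substLit hi w).2 hαw
    exact holds_compl.1 ((h.prop w hw z hz hne).holds hα hαw) ((holds_substLit hi z).1 hz')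

end Transformations

/-! ### Reduced and regular encodings, and the counting argument -/

section LowerBound

variable {V : Type} [DecidableEq V] {F : Finset (LitSet V)} {X : Finset (Lit V)} {u v l : Lit V}

/-- The clauses of `F` that contain the literal `l`. -/
def clausesWith (F : Finset (LitSet V)) (l : Lit V) : Finset (LitSet V) := F.filter fun C => l ∈ C

theorem mem_clausesWith {C : LitSet V} : C ∈ clausesWith F l ↔ C ∈ F ∧ l ∈ C := Finset.mem_filter

/-- An encoding in which every clause with a negated input is binary, and every negated input
occurs in at least two clauses. -/
structure Reduced (F : Finset (LitSet V)) (X : Finset (Lit V)) : Prop extends Encodes F X where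
  isClause : ∀ C ∈ F, IsClause C
  binary : ∀ C ∈ F, ∀ u ∈ X, u.compl ∈ C → ∃ b, C = {u.compl, b}
  two_le : ∀ u ∈ X, 2 ≤ (clausesWith F u.compl).card

theorem Encodes.exists_reduced (h : Encodes F X) (hX : 3 ≤ X.card) :
    ∃ (G : Finset (LitSet V)) (Y : Finset (Lit V)),
      Reduced G Y ∧ Y.card = X.card ∧ G.card ≤ F.card := by
  induction hk : F.card using Nat.strong_induction_on generalizing F X with
  | _ k ih =>
    obtain ⟨G₁, hG₁, h₁, hcl₁⟩ := h.exists_isClause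
    obtain ⟨G, hG, hE, hcl, hbin⟩ := h₁.exists_binary hcl₁
    have hGF : G.card ≤ k := hk ▸ hG.trans (Finset.card_le_card hG₁)
    by_cases hall : ∀ u ∈ X, 2 ≤ (clausesWith G u.compl).card
    · exact ⟨G, X, ⟨hE, hcl, hbin, hall⟩, rfl, hGF⟩
    · push Not at hall
      obtain ⟨u, hu, hlt⟩ := hall
      have hd : ∃ d, d ≠ u ∧ ∀ C ∈ G, u.compl ∈ C → C = {u.compl, d} := by
        rcases (clausesWith G u.compl).eq_empty_or_nonempty with he | ⟨C, hC⟩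
        -- With no clause containing `¬u` the condition on `d` is vacuous, and any literal other
        -- than `u` serves.
        · refine ⟨u.compl, u.compl_ne, fun C hC huC => ?_⟩
          have := mem_clausesWith.2 ⟨hC, huC⟩
          simp [he] at this
        · obtain ⟨hC', huC⟩ := mem_clausesWith.1 hC
          obtain ⟨b, rfl⟩ := hbin C hC' u hu huC
          refine ⟨b, ?_, fun D hD huD => ?_⟩
          · rintro rfl
            exact hcl _ hC' b (by simp) (by simp)
          · exact Finset.card_le_one.1 (by omega) _ (mem_clausesWith.2 ⟨hD, huD⟩) _ hC
      obtain ⟨d, hdu, hd⟩ := hd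
      obtain ⟨G', Y, hE', hY, hlt'⟩ := hE.exists_card_lt hX hu hdu hd
      obtain ⟨G'', Z, hR, hZ, hle⟩ := ih G'.card (by omega) hE' (by omega) rfl
      exact ⟨G'', Z, hR, by omega, by omega⟩

/-- An encoding in which every negated input occurs in exactly two clauses, which are binary and
contain no other negated input. -/
structure Regular (F : Finset (LitSet V)) (X : Finset (Lit V)) : Prop extends Reduced F X where
  card_eq_two : ∀ u ∈ X, (clausesWith F u.compl).card = 2
  disjoint : ∀ u ∈ X, ∀ v ∈ X, u ≠ v → ({u.compl, v.compl} : LitSet V) ∉ F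

/-- Setting to false an input whose negation lies in three clauses removes those three. If `{¬u,
¬v}` is a clause and both negations lie in exactly two, setting `v` to false removes two clauses and
leaves `¬u` in a single one, so that `Encodes.exists_card_lt` saves a third. -/
theorem Reduced.regular_or (h : Reduced F X) (hX : 4 ≤ X.card) :
    Regular F X ∨ ∃ (G : Finset (LitSet V)) (Y : Finset (Lit V)),
      Encodes G Y ∧ Y.card + 1 = X.card ∧ G.card + 3 ≤ F.card := by
  have hcard : ∀ v, (restrict F v).card + (clausesWith F v.compl).card ≤ F.card :=
    card_restrict_add_le F
  by_cases h3 : ∃ u ∈ X, 3 ≤ (clausesWith F u.compl).card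
  · obtain ⟨u, hu, h3⟩ := h3
    refine Or.inr ⟨restrict F u, X.erase u, h.toEncodes.restrict hu,
      Finset.card_erase_add_one hu, ?_⟩
    have := hcard u
    omega
  push Not at h3
  have h2 : ∀ u ∈ X, (clausesWith F u.compl).card = 2 := fun u hu => by
    have := h3 u hu
    have := h.two_le u hu
    omega
  by_cases hs : ∀ u ∈ X, ∀ v ∈ X, u ≠ v → ({u.compl, v.compl} : LitSet V) ∉ F
  · exact Or.inl ⟨h, h2, hs⟩
  · push Not at hs
    obtain ⟨u, hu, v, hv, huv, huvF⟩ := hs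
    have huv' : u ∈ X.erase v := Finset.mem_erase.2 ⟨huv, hu⟩
    have hXv := Finset.card_erase_add_one hv
    -- after setting `v` to false, a single clause with `¬ u` is left
    have hd : ∃ d, d ≠ u ∧ ∀ C ∈ restrict F v, u.compl ∈ C → C = {u.compl, d} := by
      obtain ⟨C, hC, hCne⟩ := Finset.exists_mem_ne (by rw [h2 u hu]; omega)
        ({u.compl, v.compl} : LitSet V)
      obtain ⟨hCF, huC⟩ := mem_clausesWith.1 hC
      obtain ⟨d, rfl⟩ := h.binary C hCF u hu huC
      have hdu : d ≠ u := by
        rintro rfl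
        exact h.isClause _ hCF d (by simp) (by simp)
      have hdv : d ≠ v := by
        rintro rfl
        obtain ⟨α, hα, hαu⟩ := h.sat u hu
        obtain ⟨l, hl, hαl⟩ := hα _ hCF
        rcases Finset.mem_insert.1 hl with rfl | hl
        · exact holds_compl.1 hαl hαu
        · obtain rfl := Finset.mem_singleton.1 hl
          exact holds_compl.1 ((h.prop u hu l hv huv).holds hα hαu) hαl
      have huv2 : u.compl ≠ v := fun e => h.toEncodes.compl_notMem (by omega) hu (e ▸ hv)
      refine ⟨d, hdu, fun D hD huD => ?_⟩
      obtain ⟨E, hE, rfl⟩ := Finset.mem_image.1 hD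
      obtain ⟨hEF, hvE⟩ := Finset.mem_filter.1 hE
      have hE' : E ∈ clausesWith F u.compl := mem_clausesWith.2 ⟨hEF, Finset.mem_of_mem_erase huD⟩
      have : E = {u.compl, d} := by
        by_contra hne
        have : ({{u.compl, v.compl}, {u.compl, d}, E} : Finset (LitSet V)).card ≤ 2 := by
          rw [← h2 u hu]
          apply Finset.card_le_card
          intro x hx
          simp only [Finset.mem_insert, Finset.mem_singleton] at hx
          rcases hx with rfl | rfl | rfl
          · exact mem_clausesWith.2 ⟨huvF, by simp⟩
          · exact hC
          · exact hE'
        rw [Finset.card_eq_three.2 ⟨_, _, _, hCne.symm, ?_, fun e => hne e.symm, rfl⟩] at this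
        · omega
        · rintro rfl
          exact hvE (by simp)
      rw [this, Finset.erase_eq_of_notMem]
      simp only [Finset.mem_insert, Finset.mem_singleton, not_or]
      exact ⟨huv2.symm, hdv.symm⟩
    obtain ⟨d, hdu, hd⟩ := hd
    obtain ⟨G, Y, hE, hY, hlt⟩ :=
      (h.toEncodes.restrict hv).exists_card_lt (by omega) huv' hdu hd
    refine Or.inr ⟨G, Y, hE, by omega, ?_⟩
    have := hcard v
    have := h2 v hv
    omega

/-- Double counting: each negated input lies in at least two clauses, and each clause contains at
most two negated inputs. -/
theorem Reduced.three_le (h : Reduced F X) (hX : X.card = 3) : 3 ≤ F.card := by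
  have h1 : X.card * 2 ≤ F.card * 2 := by
    refine Finset.card_mul_le_card_mul (fun (u : Lit V) (C : LitSet V) => u.compl ∈ C)
      (fun u hu => h.two_le u hu)
      fun C hC => ?_
    rcases (Finset.bipartiteBelow (fun (u : Lit V) (C : LitSet V) => u.compl ∈ C) X C).eq_empty_or_nonempty with
      he | ⟨u, hu⟩
    · simp [he]
    · obtain ⟨hu, huC⟩ := (Finset.mem_bipartiteBelow _).1 hu
      obtain ⟨b, rfl⟩ := h.binary C hC u hu huC
      refine (Finset.card_le_card (t := {u, b.compl}) fun w hw => ?_).trans Finset.card_le_two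
      have hw := ((Finset.mem_bipartiteBelow _).1 hw).2
      simpa [Lit.compl_eq_iff] using hw
  omega

/-- The clauses without negated inputs. -/
def restClauses (F : Finset (LitSet V)) (X : Finset (Lit V)) : Finset (LitSet V) :=
  F.filter fun C => ∀ u ∈ X, u.compl ∉ C

theorem Regular.card_eq (h : Regular F X) : F.card = 2 * X.card + (restClauses F X).card := by
  have h1 : (X.biUnion fun u => clausesWith F u.compl).card = X.card * 2 := by
    rw [Finset.card_biUnion, Finset.sum_const_nat h.card_eq_two]
    intro u hu v hv huv
    refine Finset.disjoint_left.2 fun C hCu hCv => ?_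
    obtain ⟨hC, huC⟩ := mem_clausesWith.1 hCu
    obtain ⟨b, rfl⟩ := h.binary C hC u hu huC
    have := (mem_clausesWith.1 hCv).2
    rcases Finset.mem_insert.1 this with e | e
    · exact huv (Lit.compl_injective e).symm
    · rw [← Finset.mem_singleton.1 e] at hC
      exact h.disjoint u hu v hv huv hC
  have h2 : F.filter (fun C => ¬ ∀ u ∈ X, u.compl ∉ C) =
      X.biUnion fun u => clausesWith F u.compl := by
    ext C
    simp only [Finset.mem_filter, Finset.mem_biUnion, mem_clausesWith]
    push Not
    tauto
  have h3 := Finset.card_filter_add_card_filter_not (s := F) (fun C => ∀ u ∈ X, u.compl ∉ C)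
  rw [h2, h1] at h3
  unfold restClauses
  omega

/-- The two neighbours of an input in a regular encoding. -/
structure IsPair {V : Type} (F : Finset (LitSet V)) (X : Finset (Lit V)) (w a b : Lit V) : Prop where
  ne : a ≠ b
  left : UP F w a
  right : UP F w b
  kill : ∀ u ∈ X, u ≠ w → UP F u a.compl ∨ UP F u b.compl
  left_notMem : a ∉ X ∧ a.compl ∉ X
  right_notMem : b ∉ X ∧ b.compl ∉ X

theorem IsPair.symm {V : Type} {F : Finset (LitSet V)} {X : Finset (Lit V)} {w a b : Lit V}
    (h : IsPair F X w a b) : IsPair F X w b a :=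
  ⟨h.ne.symm, h.right, h.left, fun u hu huw => (h.kill u hu huw).symm,
    h.right_notMem, h.left_notMem⟩

/-- The neighbours are the second literals of the two clauses containing `¬w`. Another input must
derive `¬w` through one of these clauses, which refutes that neighbour. -/
theorem Regular.exists_isPair (h : Regular F X) (hX : 3 ≤ X.card) {w : Lit V} (hw : w ∈ X) :
    ∃ a b, IsPair F X w a b := by
  have key : ∀ a, {w.compl, a} ∈ F → UP F w a ∧ a ∉ X ∧ a.compl ∉ X := by
    intro a ha
    have hUP : UP F w a := by
      refine .step _ a ha (by simp) fun m hm hma => ?_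
      have : m = w.compl := by simpa [hma] using hm
      rw [this, Lit.compl_compl]
      exact .start
    refine ⟨hUP, fun haX => ?_, fun haX => ?_⟩
    · by_cases haw : w = a
      · subst haw
        exact h.isClause _ ha w (by simp) (by simp)
      · exact h.consistent hw hUP (h.prop w hw a haX haw)
    · by_cases haw : w = a.compl
      · subst haw
        exact h.consistent haX .start (by simpa using hUP)
      · exact h.disjoint w hw _ haX haw (by simpa using ha)
  obtain ⟨C, D, hCD, hp⟩ := Finset.card_eq_two.1 (h.card_eq_two w hw)
  have hC := mem_clausesWith.1 (hp ▸ Finset.mem_insert_self C {D})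
  have hD := mem_clausesWith.1 (hp ▸ Finset.mem_insert_of_mem (Finset.mem_singleton_self D))
  obtain ⟨a, rfl⟩ := h.binary C hC.1 w hw hC.2
  obtain ⟨b, rfl⟩ := h.binary D hD.1 w hw hD.2
  obtain ⟨ha, ha'⟩ := key a hC.1
  obtain ⟨hb, hb'⟩ := key b hD.1
  refine ⟨a, b, fun e => hCD (by rw [e]), ha, hb, fun u hu huw => ?_, ha', hb'⟩
  have hne : ∀ c, UP F w c → c ≠ w.compl := by
    rintro _ hc rfl
    exact h.consistent hw .start hc
  have hprop := h.prop u hu w hw huw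
  generalize hc : w.compl = c at hprop
  cases hprop with
  | start => exact absurd hu (hc ▸ h.compl_notMem hX hw)
  | step E l hE hl hUP =>
    subst hc
    have hE : E ∈ clausesWith F w.compl := mem_clausesWith.2 ⟨hE, hl⟩
    rw [hp, Finset.mem_insert, Finset.mem_singleton] at hE
    rcases hE with rfl | rfl
    · exact Or.inl (hUP a (by simp) (hne a ha))
    · exact Or.inr (hUP b (by simp) (hne b hb))

/-- Sending each literal to the clause that derives it is injective, because all other literals of
that clause are refuted. The clause cannot contain a negated input other than `¬u`, since `u` never
propagates another input. -/
theorem Regular.card_propagated_le (h : Regular F X) (hu : u ∈ X) (T : Finset (Lit V))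
    (hT : ∀ l ∈ T, UP F u l ∧ l ∉ X ∧ l.compl ∉ X) : T.card ≤ (restClauses F X).card + 2 := by
  have hex : ∀ l ∈ T, ∃ C, C ∈ restClauses F X ∪ clausesWith F u.compl ∧ l ∈ C ∧
      ∀ m ∈ C, m ≠ l → UP F u m.compl := by
    intro l hl
    obtain ⟨hUP, hlX, hlX'⟩ := hT l hl
    cases hUP with
    | start => exact absurd hu hlX
    | step C l hC hlC hUP =>
      refine ⟨C, ?_, hlC, hUP⟩
      by_cases hr : ∀ w ∈ X, w.compl ∉ C
      · exact Finset.mem_union_left _ (Finset.mem_filter.2 ⟨hC, hr⟩)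
      · push Not at hr
        obtain ⟨w, hw, hwC⟩ := hr
        have hUPw := hUP _ hwC (by rintro rfl; exact hlX' (by simpa using hw))
        have : u = w := by
          by_contra huw
          exact h.consistent hu (h.prop u hu w hw huw) hUPw
        subst this
        exact Finset.mem_union_right _ (mem_clausesWith.2 ⟨hC, hwC⟩)
  choose! f hf hlf hUP using hex
  calc T.card ≤ (restClauses F X ∪ clausesWith F u.compl).card := by
        refine Finset.card_le_card_of_injOn f (fun l hl => hf l hl) fun l hl m hm hlm => ?_
        by_contra hne
        exact h.consistent hu (hT l hl).1 (hUP m hm l (hlm ▸ hlf l hl) hne)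
    _ ≤ _ := (Finset.card_union_le _ _).trans_eq (by rw [h.card_eq_two u hu])

/-- Each `w ∈ J` propagates the common neighbour `l`, so it must refute the second neighbour of
every other member of `J`. If `J` has at least three members, this gives `|J| + 1` distinct literals
propagated from one input, against the bound `r + 2`. -/
theorem Regular.card_sharing_le (h : Regular F X) (J : Finset (Lit V))
    (hJX : J ⊆ X) (l : Lit V) (hJ : ∀ w ∈ J, ∃ b, IsPair F X w l b) :
    J.card ≤ 2 ∨ J.card ≤ (restClauses F X).card + 1 := by
  choose! o ho using hJ
  have hUP : ∀ w ∈ J, ∀ w' ∈ J, w ≠ w' → UP F w (o w').compl := fun w hw w' hw' hww' =>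
    ((ho w' hw').kill w (hJX hw) hww').resolve_left
      (h.consistent (hJX hw) (ho w hw).left)
  have hinj : Set.InjOn (fun w => (o w).compl) J := by
    intro w hw w' hw' e
    by_contra hww'
    have e : (o w).compl = (o w').compl := e
    exact h.consistent (hJX hw) (ho w hw).right (e ▸ hUP w hw w' hw' hww')
  by_cases h2 : J.card ≤ 2
  · exact Or.inl h2
  refine Or.inr ?_
  push Not at h2
  obtain ⟨w, hw⟩ := Finset.card_pos.1 (by omega : 0 < J.card)
  have hTw := h.card_propagated_le (hJX hw)
    (insert (o w) (insert l ((J.erase w).image fun w' => (o w').compl))) ?_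
  · rw [Finset.card_insert_of_notMem, Finset.card_insert_of_notMem, Finset.card_image_of_injOn,
      Finset.card_erase_of_mem hw] at hTw
    · omega
    · exact hinj.mono (Finset.coe_subset.2 (Finset.erase_subset _ _))
    · intro hl
      obtain ⟨w', hw', e⟩ := Finset.mem_image.1 hl
      have hw' := Finset.mem_of_mem_erase hw'
      exact h.consistent (hJX hw') (ho w' hw').right (e ▸ (ho w' hw').left)
    · intro hl
      rcases Finset.mem_insert.1 hl with e | hl
      · exact (ho w hw).ne e.symm
      · obtain ⟨w', hw', e⟩ := Finset.mem_image.1 hl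
        obtain ⟨hww', hw'⟩ := Finset.mem_erase.1 hw'
        -- A third member `z` refutes both second neighbours, so these cannot be complementary.
        obtain ⟨z, hz, hzw⟩ : ∃ z ∈ J, z ∉ ({w, w'} : Finset (Lit V)) :=
          Finset.exists_mem_notMem_of_card_lt_card (Finset.card_le_two.trans_lt h2)
        simp only [Finset.mem_insert, Finset.mem_singleton, not_or] at hzw
        have e : (o w').compl = o w := e
        exact h.consistent (hJX hz) (hUP z hz w' hw' hzw.2) (e ▸ hUP z hz w hw hzw.1)
  · intro x hx
    rcases Finset.mem_insert.1 hx with rfl | hx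
    · exact ⟨(ho w hw).right, (ho w hw).right_notMem⟩
    · rcases Finset.mem_insert.1 hx with rfl | hx
      · exact ⟨(ho w hw).left, (ho w hw).left_notMem⟩
      · obtain ⟨w', hw', rfl⟩ := Finset.mem_image.1 hx
        obtain ⟨hww', hw'⟩ := Finset.mem_erase.1 hw'
        have := (ho w' hw').right_notMem
        exact ⟨hUP w hw w' hw' hww'.symm, this.2, by simpa using this.1⟩

/-- Choose for each `w ≠ u` a neighbour that `u` refutes: there are at most `r + 2` values, each
taken by a bounded number of inputs. -/
theorem Regular.card_inputs_le (h : Regular F X) (hX : 3 ≤ X.card) :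
    X.card ≤ max 2 ((restClauses F X).card + 1) * ((restClauses F X).card + 2) + 1 := by
  obtain ⟨u, hu⟩ := Finset.card_pos.1 (by omega : 0 < X.card)
  have hex : ∀ w ∈ X.erase u, ∃ l, UP F u l.compl ∧ ∃ b, IsPair F X w l b := by
    intro w hw
    obtain ⟨hwu, hw⟩ := Finset.mem_erase.1 hw
    obtain ⟨a, b, hab⟩ := h.exists_isPair hX hw
    rcases hab.kill u hu hwu.symm with hk | hk
    · exact ⟨a, hk, b, hab⟩
    · exact ⟨b, hk, a, hab.symm⟩
  choose! c hcu hc using hex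
  have h1 : ((X.erase u).image c).card ≤ (restClauses F X).card + 2 := by
    rw [← Finset.card_image_of_injective _ Lit.compl_injective]
    refine h.card_propagated_le hu _ fun l hl => ?_
    obtain ⟨m, hm, rfl⟩ := Finset.mem_image.1 hl
    obtain ⟨w, hw, rfl⟩ := Finset.mem_image.1 hm
    obtain ⟨b, hb⟩ := hc w hw
    exact ⟨hcu w hw, hb.left_notMem.2, by simpa using hb.left_notMem.1⟩
  have h2 := Finset.card_le_mul_card_image (f := c) (X.erase u)
    (max 2 ((restClauses F X).card + 1)) fun l _ => by
      have := h.card_sharing_le ((X.erase u).filter fun w => c w = l)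
        ((Finset.filter_subset _ _).trans (Finset.erase_subset _ _)) l fun w hw => by
          obtain ⟨hw', rfl⟩ := Finset.mem_filter.1 hw
          exact hc w hw'
      exact le_max_iff.2 this
  have h3 := Finset.card_erase_add_one hu
  have h4 := Nat.mul_le_mul_left (max 2 ((restClauses F X).card + 1)) h1
  omega

theorem Encodes.card_lower_bound (n : ℕ) (hn : 3 ≤ n) (h : Encodes F X) (hX : X.card = n) :
    (n ≤ 8 → 3 * n ≤ F.card + 6) ∧
    (9 ≤ n → 2 * (n : ℝ) + Real.sqrt (n : ℝ) - 2 ≤ (F.card : ℝ)) := by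
  induction n, hn using Nat.le_induction generalizing F X with
  | base =>
    obtain ⟨G, Y, hR, hY, hle⟩ := h.exists_reduced hX.ge
    have := hR.three_le (by omega)
    exact ⟨fun _ => by omega, fun h9 => by omega⟩
  | succ n hn ih =>
    obtain ⟨G, Y, hR, hY, hle⟩ := h.exists_reduced (by omega)
    rcases hR.regular_or (by omega) with hreg | ⟨G', Y', hE, hY', hle'⟩
    · have hG := hreg.card_eq
      have hb := hreg.card_inputs_le (by omega)
      rw [hY, hX] at hb hG
      generalize (restClauses G Y).card = r at hb hG
      -- For `r ≥ 1` this is `(r + 1)(r + 2) + 1 ≤ (r + 2)²`; `r = 0` allows at most five inputs.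
      have hsq : 8 ≤ n → n + 1 ≤ (r + 2) ^ 2 := by
        intro h8
        rcases Nat.eq_zero_or_pos r with rfl | hr
        · norm_num at hb
          omega
        · rw [max_eq_right (by omega)] at hb
          nlinarith
      refine ⟨fun h8 => ?_, fun h9 => ?_⟩
      · by_contra hlt
        have hr : r ≤ 1 := by omega
        -- A counterexample with `r = 0` needs at least seven inputs but at most five are possible;
        -- with `r = 1` it needs eight against at most seven.
        interval_cases r <;> norm_num at hb <;> omega
      · have hs : Real.sqrt ((n + 1 : ℕ) : ℝ) ≤ (r : ℝ) + 2 := by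
          rw [Real.sqrt_le_left (by positivity)]
          exact_mod_cast hsq (by omega)
        have : ((2 * (n + 1) + r : ℕ) : ℝ) ≤ F.card := by
          exact_mod_cast hG ▸ hle
        push_cast at this hs ⊢
        linarith
    · obtain ⟨ih1, ih2⟩ := ih hE (by omega)
      refine ⟨fun h8 => ?_, fun h9 => ?_⟩
      · have := ih1 (by omega)
        omega
      · have hF : (G'.card : ℝ) + 3 ≤ F.card := by exact_mod_cast hle'.trans hle
        -- At nine inputs the induction falls back on the linear bound for eight: `18 + 3 ≥ 2 * 9 +
        -- 3 - 2`.
        rcases Nat.lt_or_ge n 9 with h9' | h9'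
        · have hn8 : n = 8 := by omega
          subst hn8
          have h18 : (18 : ℝ) ≤ G'.card := by
            have := ih1 le_rfl
            exact_mod_cast (by omega : 18 ≤ G'.card)
          have hs : Real.sqrt ((8 + 1 : ℕ) : ℝ) ≤ 3 := by
            rw [Real.sqrt_le_left (by norm_num)]
            norm_num
          push_cast at hs ⊢
          linarith
        · have := ih2 h9'
          have hs : Real.sqrt ((n + 1 : ℕ) : ℝ) ≤ Real.sqrt (n : ℝ) + 1 := by
            rw [Real.sqrt_le_left (by positivity)]
            have := Real.sq_sqrt (Nat.cast_nonneg (α := ℝ) n)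
            have := Real.sqrt_nonneg (n : ℝ)
            push_cast
            nlinarith
          push_cast at hs ⊢
          linarith

end LowerBound

/-! ### Transfer to P-encodings, and the upper-bound construction -/

theorem IsPEncoding.encodes {n ℓ : ℕ} {φ : Formula (Vars n ℓ)} (h : IsPEncoding φ) :
    Encodes φ.clauses (Finset.univ.image fun i : Fin n => pos (input ℓ i)) := by
  constructor
  · intro u hu
    obtain ⟨i, -, rfl⟩ := Finset.mem_image.1 hu
    obtain ⟨α, hα⟩ := h.satisfiable i
    refine ⟨α, fun C hC => hα C (Finset.mem_insert_of_mem hC), ?_⟩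
    obtain ⟨l, hl, hαl⟩ := hα _ (Finset.mem_insert_self _ _)
    exact Finset.mem_singleton.1 hl ▸ hαl
  · intro u hu v hv huv
    obtain ⟨i, -, rfl⟩ := Finset.mem_image.1 hu
    obtain ⟨j, -, rfl⟩ := Finset.mem_image.1 hv
    exact unitDerives_singleton_iff.1 (h.derives i j fun e => huv (by rw [e]))

theorem card_inputs (n ℓ : ℕ) :
    (Finset.univ.image fun i : Fin n => pos (input ℓ i)).card = n := by
  rw [Finset.card_image_of_injective, Finset.card_fin]
  intro i j e
  exact Sum.inl_injective (congrArg Prod.fst e)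

theorem isPEncoding_of_UP {n ℓ : ℕ} {φ : Formula (Vars n ℓ)}
    (h1 : ∀ i, ∃ α, Models α φ.clauses ∧ α (input ℓ i) = true)
    (h2 : ∀ i j, i ≠ j → UP φ.clauses (pos (input ℓ i)) (neg (input ℓ j))) : IsPEncoding φ where
  satisfiable i := by
    obtain ⟨α, hα, hαi⟩ := h1 i
    refine ⟨α, fun C hC => ?_⟩
    rcases Finset.mem_insert.1 hC with rfl | hC
    · exact ⟨_, Finset.mem_singleton_self _, hαi⟩
    · exact hα C hC
  derives i j hij := unitDerives_singleton_iff.2 (h2 i j hij)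

/-- Renaming the variable of a literal. -/
def Lit.rename {V W : Type} (ρ : V → W) (l : Lit V) : Lit W := (ρ l.1, l.2)

theorem Lit.rename_injective {V W : Type} {ρ : V → W} (hρ : Function.Injective ρ) :
    Function.Injective (Lit.rename ρ) := fun _ _ e =>
  Prod.ext (hρ (congrArg (fun l : Lit W => l.1) e)) (congrArg (fun l : Lit W => l.2) e)

theorem UP.rename {V W : Type} [DecidableEq W] {F : Finset (LitSet V)} {G : Finset (LitSet W)}
    {ρ : V → W} (hFG : F.image (fun C => C.image (Lit.rename ρ)) ⊆ G) {u l : Lit V} {v : Lit W}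
    (hv : UP G v (u.rename ρ)) (h : UP F u l) : UP G v (l.rename ρ) := by
  induction h with
  | start => exact hv
  | step C l hC hl _ ih =>
    refine .step _ _ (hFG (Finset.mem_image_of_mem _ hC)) (Finset.mem_image_of_mem _ hl) ?_
    intro m hm hml
    obtain ⟨m, hm', rfl⟩ := Finset.mem_image.1 hm
    exact ih m hm' fun e => hml (by rw [e])

theorem UP.of_pair {V : Type} [DecidableEq V] {F : Finset (LitSet V)} {u l m : Lit V}
    (hF : {m.compl, l} ∈ F) (h : UP F u m) : UP F u l := by
  refine .step _ l hF (by simp) fun k hk hkl => ?_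
  have : k = m.compl := by simpa [hkl] using hk
  rwa [this, Lit.compl_compl]

theorem isClause_neg_pair {V : Type} [DecidableEq V] {x : V} {m : Lit V} (h : m.1 ≠ x) :
    IsClause ({neg x, m} : LitSet V) := by
  intro k hk hk'
  simp only [Finset.mem_insert, Finset.mem_singleton] at hk hk'
  rcases hk with rfl | rfl <;> rcases hk' with e | e
  · exact Lit.compl_ne _ e
  · exact h (congrArg Prod.fst e).symm
  · exact h (congrArg Prod.fst e)
  · exact Lit.compl_ne _ e

/-- The renaming that turns the first input into an auxiliary variable. -/
def shiftVar {n ℓ : ℕ} : Vars (n + 1) ℓ → Vars (n + 2) (ℓ + 1) :=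
  Sum.elim (Fin.cases (Sum.inr (Fin.last ℓ)) fun i => Sum.inl i.succ.succ)
    fun j => Sum.inr j.castSucc

theorem shiftVar_injective {n ℓ : ℕ} : Function.Injective (shiftVar (n := n) (ℓ := ℓ)) := by
  rintro (i | i) (j | j) h
  · induction i using Fin.cases <;> induction j using Fin.cases <;> simp_all [shiftVar]
  · induction i using Fin.cases <;> simp_all [shiftVar, Fin.ext_iff]
    omega
  · induction j using Fin.cases <;> simp_all [shiftVar, Fin.ext_iff]
    omega
  · simpa [shiftVar] using h

theorem shiftVar_ne {n ℓ : ℕ} (v : Vars (n + 1) ℓ) :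
    shiftVar v ≠ Sum.inl 0 ∧ shiftVar v ≠ Sum.inl 1 := by
  rcases v with i | j
  · induction i using Fin.cases <;> simp [shiftVar, Fin.ext_iff]
  · simp [shiftVar]

/-- An encoding for `n + 1` inputs yields one for `n + 2` inputs with three more clauses: two new
inputs share the role of the first input. -/
theorem IsPEncoding.exists_succ {n ℓ : ℕ} {φ : Formula (Vars (n + 1) ℓ)} (h : IsPEncoding φ) :
    ∃ ψ : Formula (Vars (n + 2) (ℓ + 1)), IsPEncoding ψ ∧ ψ.size ≤ φ.size + 3 := by
  let y : Vars (n + 2) (ℓ + 1) := shiftVar (input ℓ 0)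
  let x₀ : Vars (n + 2) (ℓ + 1) := Sum.inl 0
  let x₁ : Vars (n + 2) (ℓ + 1) := Sum.inl 1
  have hx : x₁ ≠ x₀ := by simp [x₀, x₁]
  have hy₀ : y ≠ x₀ := (shiftVar_ne _).1
  have hy₁ : y ≠ x₁ := (shiftVar_ne _).2
  let G : Finset (LitSet (Vars (n + 2) (ℓ + 1))) :=
    φ.clauses.image (fun C => C.image (Lit.rename shiftVar)) ∪
      {{neg x₀, pos y}, {neg x₁, pos y}, {neg x₀, neg x₁}}
  have hsub : φ.clauses.image (fun C => C.image (Lit.rename shiftVar)) ⊆ G :=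
    Finset.subset_union_left
  have hG0 : {neg x₀, pos y} ∈ G := by simp [G]
  have hG1 : {neg x₁, pos y} ∈ G := by simp [G]
  have hG01 : {neg x₀, neg x₁} ∈ G := by simp [G]
  have hcl : ∀ C ∈ G, IsClause C := by
    intro C hC
    rcases Finset.mem_union.1 hC with hC | hC
    · obtain ⟨D, hD, rfl⟩ := Finset.mem_image.1 hC
      intro l hl hl'
      obtain ⟨m, hm, rfl⟩ := Finset.mem_image.1 hl
      obtain ⟨k, hk, e⟩ := Finset.mem_image.1 hl'
      have : k = m.compl := Lit.rename_injective shiftVar_injective e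
      exact φ.isClause D hD m hm (this ▸ hk)
    · simp only [Finset.mem_insert, Finset.mem_singleton] at hC
      rcases hC with rfl | rfl | rfl
      · exact isClause_neg_pair hy₀
      · exact isClause_neg_pair hy₁
      · exact isClause_neg_pair hx
  have hE := h.encodes
  have hin : ∀ i : Fin (n + 1), pos (input ℓ i) ∈
      Finset.univ.image fun i : Fin (n + 1) => pos (input ℓ i) := fun i =>
    Finset.mem_image_of_mem _ (Finset.mem_univ i)
  have hUPφ : ∀ i j : Fin (n + 1), i ≠ j → UP φ.clauses (pos (input ℓ i)) (neg (input ℓ j)) :=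
    fun i j hij => unitDerives_singleton_iff.1 (h.derives i j hij)
  -- models of `φ` extend to models of the new clauses
  have hmod : ∀ (i : Fin (n + 1)) (b₀ b₁ : Bool), (i ≠ 0 → b₀ = false ∧ b₁ = false) →
      (b₀ = false ∨ b₁ = false) → ∃ α, Models α G ∧ α x₀ = b₀ ∧ α x₁ = b₁ ∧
        α (shiftVar (input ℓ i)) = true := by
    intro i b₀ b₁ hb hb'
    obtain ⟨β, hβ, hβi⟩ := hE.sat _ (hin i)
    have hβi : β (input ℓ i) = true := hβi
    -- The default `false` concerns only variables outside the range of `shiftVar`; the values at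
    -- `x₀` and `x₁` are then overwritten.
    let α : Vars (n + 2) (ℓ + 1) → Bool :=
      Function.update (Function.update (Function.extend shiftVar β fun _ => false) x₀ b₀) x₁ b₁
    have hα : ∀ v, α (shiftVar v) = β v := by
      intro v
      simp only [α]
      rw [Function.update_of_ne (shiftVar_ne v).2, Function.update_of_ne (shiftVar_ne v).1,
        shiftVar_injective.extend_apply]
    have hα0 : α x₀ = b₀ := by
      simp only [α]
      rw [Function.update_of_ne hx.symm, Function.update_self]
    have hα1 : α x₁ = b₁ := by simp only [α, Function.update_self]
    refine ⟨α, fun C hC => ?_, hα0, hα1, (hα _).trans hβi⟩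
    have hyor : α y = true ∨ (b₀ = false ∧ b₁ = false) := by
      by_cases hi : i = 0
      · subst hi
        exact Or.inl ((hα _).trans hβi)
      · exact Or.inr (hb hi)
    rcases Finset.mem_union.1 hC with hC | hC
    · obtain ⟨D, hD, rfl⟩ := Finset.mem_image.1 hC
      obtain ⟨l, hl, hβl⟩ := hβ D hD
      exact ⟨_, Finset.mem_image_of_mem _ hl, (hα _).trans hβl⟩
    · simp only [Finset.mem_insert, Finset.mem_singleton] at hC
      rcases hC with rfl | rfl | rfl
      · rcases hyor with hy | hf
        · exact ⟨pos y, by simp, hy⟩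
        · exact ⟨neg x₀, by simp, hα0.trans hf.1⟩
      · rcases hyor with hy | hf
        · exact ⟨pos y, by simp, hy⟩
        · exact ⟨neg x₁, by simp, hα1.trans hf.2⟩
      · rcases hb' with hf | hf
        · exact ⟨neg x₀, by simp, hα0.trans hf⟩
        · exact ⟨neg x₁, by simp, hα1.trans hf⟩
  have h0y : UP G (pos x₀) (pos y) := .of_pair (m := pos x₀) hG0 .start
  have h1y : UP G (pos x₁) (pos y) := .of_pair (m := pos x₁) hG1 .start
  -- The clauses `{¬x₀, y}` and `{¬x₁, y}` serve in both directions: a new input activates `y`, and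
  -- refuting `y` refutes both new inputs.
  have hy0 : ∀ {u}, UP G u (neg y) → UP G u (neg x₀) := fun hu =>
    .of_pair (m := neg y) (by rw [Finset.pair_comm]; exact hG0) hu
  have hy1 : ∀ {u}, UP G u (neg y) → UP G u (neg x₁) := fun hu =>
    .of_pair (m := neg y) (by rw [Finset.pair_comm]; exact hG1) hu
  have hyj : ∀ {u} (j : Fin n), UP G u (pos y) →
      UP G u (neg (input (ℓ + 1) j.succ.succ)) := fun j hu =>
    UP.rename hsub (u := pos (input ℓ 0)) (l := neg (input ℓ j.succ)) hu
      (hUPφ 0 j.succ (Fin.succ_ne_zero j).symm)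
  have hij : ∀ (i : Fin n) (j : Fin (n + 1)), i.succ ≠ j →
      UP G (pos (input (ℓ + 1) i.succ.succ)) ((neg (input ℓ j)).rename shiftVar) := fun i j hij =>
    UP.rename hsub (u := pos (input ℓ i.succ)) .start (hUPφ i.succ j hij)
  refine ⟨⟨G, hcl⟩, isPEncoding_of_UP ?_ ?_, ?_⟩
  · intro i
    refine Fin.cases ?_ (fun i => Fin.cases ?_ (fun i => ?_) i) i
    · obtain ⟨α, hα, h0, -⟩ := hmod 0 true false (fun h => absurd rfl h) (Or.inr rfl)
      exact ⟨α, hα, h0⟩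
    · obtain ⟨α, hα, -, h1, -⟩ := hmod 0 false true (fun h => absurd rfl h) (Or.inl rfl)
      exact ⟨α, hα, h1⟩
    · obtain ⟨α, hα, -, -, hi⟩ := hmod i.succ false false (fun _ => ⟨rfl, rfl⟩) (Or.inl rfl)
      exact ⟨α, hα, hi⟩
  · intro i j
    refine Fin.cases ?_ (fun i => Fin.cases ?_ (fun i => ?_) i) i <;>
      refine Fin.cases ?_ (fun j => Fin.cases ?_ (fun j => ?_) j) j <;> intro hne
    · exact absurd rfl hne
    · exact .of_pair (m := pos x₀) hG01 .start
    · exact hyj j h0y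
    · exact .of_pair (m := pos x₁) (by rw [Finset.pair_comm]; exact hG01) .start
    · exact absurd rfl hne
    · exact hyj j h1y
    · exact hy0 (hij i 0 (Fin.succ_ne_zero i))
    · exact hy1 (hij i 0 (Fin.succ_ne_zero i))
    · exact hij i j.succ fun e => hne (by rw [e])
  · refine (Finset.card_union_le _ _).trans (Nat.add_le_add Finset.card_image_le ?_)
    exact Finset.card_le_three

theorem pairwise_three_size_le : (pairwise 3).size ≤ 3 := by decide

theorem exists_isPEncoding_size_le (n : ℕ) (hn : 3 ≤ n) :
    ∃ (ℓ : ℕ) (φ : Formula (Vars n ℓ)), IsPEncoding φ ∧ φ.size + 6 ≤ 3 * n := by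
  induction n, hn using Nat.le_induction with
  | base => exact ⟨0, pairwise 3, pairwise_isPEncoding 3, by have := pairwise_three_size_le; omega⟩
  | succ n hn ih =>
    obtain ⟨ℓ, φ, hφ, hle⟩ := ih
    obtain ⟨n, rfl⟩ := Nat.exists_eq_succ_of_ne_zero (by omega : n ≠ 0)
    obtain ⟨ψ, hψ, hle'⟩ := hφ.exists_succ
    exact ⟨ℓ + 1, ψ, hψ, by omega⟩

end PEnc

theorem mainTheorem4 (n : ℕ) (hn : 3 ≤ n) :
    (n ≤ 8 → PEnc.pEncSize n = 3 * n - 6) ∧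
    (9 ≤ n → 2 * (n : ℝ) + Real.sqrt (n : ℝ) - 2 ≤ (PEnc.pEncSize n : ℝ)) := by
  obtain ⟨⟨ℓ, φ, hφ, hsize⟩, hmin⟩ := PEnc.pEncSize_isLeast n
  obtain ⟨h1, h2⟩ := hφ.encodes.card_lower_bound n hn (PEnc.card_inputs n ℓ)
  rw [← hsize]
  refine ⟨fun h8 => ?_, h2⟩
  obtain ⟨k, ψ, hψ, hle⟩ := PEnc.exists_isPEncoding_size_le n hn
  have h3 : PEnc.pEncSize n ≤ ψ.size := hmin ⟨k, ψ, hψ, rfl⟩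
  have h4 : 3 * n ≤ φ.size + 6 := h1 h8
  omega
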